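/- Let $M$ be a smooth Kähler manifold of real dimension $4$, with Riemannian metric $\langle\,,\rangle$ and complex-structure tensor $J$ (so $J$ is orthogonal, $J^2=-1$ and $\nabla J=0$). Let $(x_1,x_2,x_3,x_4)$ be smooth orthogonal local coordinates on an open set $U\subset M$, i.e. $\langle\partial/\partial x_i,\partial/\partial x_j\rangle=0$ on $U$ for $i\ne j$; put $a_i=\sqrt{\langle\partial/\partial x_i,\partial/\partial x_i\rangle}$ and let $e_i=\frac1{a_i}\frac{\partial}{\partial x_i}$ be the associated orthonormal frame. Let $R_{XY}Z=\nabla_{[X,Y]}Z-\nabla_X(\nabla_YZ)+\nabla_Y(\nabla_XZ)$, $R_{ijkl}=\langle R_{e_ie_j}e_k,e_l\rangle$, let $r=\sum_{i,j}R_{ijij}$ be the scalar curvature, and let $a_{ij}=\langle Je_i,e_j\rangle$. Then at every point of $U$, $$r=\frac{2}{a_{12}^2}(R_{1212}+R_{3434})=\frac{2}{a_{13}^2}(R_{1313}+R_{2424})=\frac{2}{a_{14}^2}(R_{1414}+R_{2323}),$$ where each expression is asserted wherever its denominator is nonzero; where $a_{1j}=0$, the corresponding sum $R_{1j1j}+R_{klkl}$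 (with $\{1,j,k,l\}=\{1,2,3,4\}$) vanishes. Consequently $R_{1212}+R_{3434}$, $R_{1313}+R_{2424}$ and $R_{1414}+R_{2323}$ all have the same sign: each of these sums with $a_{1j}\neq0$ has the same sign as $r$ (positive, zero or negative), the others vanish, and so either all three are $\ge0$ or all three are $\le0$. -/

import Mathlib

open scoped Manifold ContDiff Bundle

noncomputable section

namespace OrthCoord

/-! ### Local Riemannian geometry in coordinates

A metric on an open subset of `ℝⁿ` is given by its Gram matrix `g x = (⟨∂ᵢ, ∂ⱼ⟩)ᵢⱼ`.  Vector fields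
are maps `ℝⁿ → ℝⁿ`; the coordinate field `∂ᵢ` is the constant field `EuclideanSpace.single i 1`. -/

section Local

variable {n : ℕ}

/-- The `i`-th coordinate vector `∂ᵢ` of `ℝⁿ`. -/
def basisVec (i : Fin n) : EuclideanSpace ℝ (Fin n) := EuclideanSpace.single i 1

/-- The partial derivative `∂f/∂xᵢ` at `x`. -/
def partialDeriv (i : Fin n) (f : EuclideanSpace ℝ (Fin n) → ℝ)
    (x : EuclideanSpace ℝ (Fin n)) : ℝ :=
  fderiv ℝ f x (basisVec i)

/-- The inner product `⟨u, v⟩ = ∑ gᵢⱼ(x) uᵢ vⱼ` at the point `x`. -/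
def metricInner (g : EuclideanSpace ℝ (Fin n) → Matrix (Fin n) (Fin n) ℝ)
    (x u v : EuclideanSpace ℝ (Fin n)) : ℝ :=
  ∑ i, ∑ j, g x i j * u i * v j

/-- The Christoffel symbol
`Γᵏᵢⱼ = ½ ∑ₗ gᵏˡ (∂ᵢ gⱼₗ + ∂ⱼ gᵢₗ - ∂ₗ gᵢⱼ)` of the Levi-Civita connection. -/
def christoffel (g : EuclideanSpace ℝ (Fin n) → Matrix (Fin n) (Fin n) ℝ)
    (k i j : Fin n) (x : EuclideanSpace ℝ (Fin n)) : ℝ :=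
  (1 / 2 : ℝ) * ∑ l, (g x)⁻¹ k l *
    (partialDeriv i (fun y => g y j l) x + partialDeriv j (fun y => g y i l) x
      - partialDeriv l (fun y => g y i j) x)

/-- The Levi-Civita covariant derivative `∇_X Y` of vector fields:
`(∇_X Y)ᵏ = X(Yᵏ) + ∑ᵢⱼ Γᵏᵢⱼ Xⁱ Yʲ`. -/
def covDeriv (g : EuclideanSpace ℝ (Fin n) → Matrix (Fin n) (Fin n) ℝ)
    (X Y : EuclideanSpace ℝ (Fin n) → EuclideanSpace ℝ (Fin n))
    (x : EuclideanSpace ℝ (Fin n)) : EuclideanSpace ℝ (Fin n) :=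
  fderiv ℝ Y x (X x) +
    WithLp.toLp 2 (fun k => ∑ i, ∑ j, christoffel g k i j x * X x i * Y x j)

/-- The curvature operator, with the sign convention
`R_{XY} Z = ∇_{[X,Y]} Z - ∇_X (∇_Y Z) + ∇_Y (∇_X Z)`. -/
def curvOp (g : EuclideanSpace ℝ (Fin n) → Matrix (Fin n) (Fin n) ℝ)
    (X Y Z : EuclideanSpace ℝ (Fin n) → EuclideanSpace ℝ (Fin n))
    (x : EuclideanSpace ℝ (Fin n)) : EuclideanSpace ℝ (Fin n) :=
  covDeriv g (VectorField.lieBracket ℝ X Y) Z x - covDeriv g X (covDeriv g Y Z) x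
    + covDeriv g Y (covDeriv g X Z) x

/-- The curvature tensor `⟨R_{uv} w, z⟩` at `x`.  The value of `R_{XY} Z` at `x` depends only on the
values of `X, Y, Z` at `x`; the vectors `u, v, w` are extended with constant coefficients. -/
def riemann (g : EuclideanSpace ℝ (Fin n) → Matrix (Fin n) (Fin n) ℝ)
    (x u v w z : EuclideanSpace ℝ (Fin n)) : ℝ :=
  metricInner g x (curvOp g (fun _ => u) (fun _ => v) (fun _ => w) x) z

/-- The scalar curvature `∑ gⁱᵏ gʲˡ ⟨R_{∂ᵢ∂ⱼ} ∂ₖ, ∂ₗ⟩` at `x`, which is the sum of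
`⟨R_{eᵢeⱼ} eᵢ, eⱼ⟩` over an orthonormal basis. -/
def scalarCurv (g : EuclideanSpace ℝ (Fin n) → Matrix (Fin n) (Fin n) ℝ)
    (x : EuclideanSpace ℝ (Fin n)) : ℝ :=
  ∑ i, ∑ j, ∑ k, ∑ l, (g x)⁻¹ i k * (g x)⁻¹ j l *
    riemann g x (basisVec i) (basisVec j) (basisVec k) (basisVec l)

end Local

/-! ### Riemannian manifolds in a chart

Points of the domain of a chart `φ` are named by their coordinates `x ∈ φ.target`. -/

section Manifold

variable {n : ℕ} {M : Type*} [TopologicalSpace M] [ChartedSpace (EuclideanSpace ℝ (Fin n)) M]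

/-- The coordinate vector `∂/∂xᵢ ∈ T_p M` of the chart `φ` at the point `p = φ⁻¹(x)`. -/
def coordVec (φ : OpenPartialHomeomorph M (EuclideanSpace ℝ (Fin n))) (i : Fin n)
    (x : EuclideanSpace ℝ (Fin n)) : TangentSpace (𝓡 n) (φ.symm x) :=
  mfderiv (𝓡 n) (𝓡 n) φ.symm x (basisVec i)

/-- An endomorphism field `J` of the tangent bundle, read in the chart `φ`. -/
def chartEndo (J : ∀ p : M, TangentSpace (𝓡 n) p →L[ℝ] TangentSpace (𝓡 n) p)
    (φ : OpenPartialHomeomorph M (EuclideanSpace ℝ (Fin n)))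
    (x v : EuclideanSpace ℝ (Fin n)) : EuclideanSpace ℝ (Fin n) :=
  mfderiv (𝓡 n) (𝓡 n) φ (φ.symm x) (J (φ.symm x) (mfderiv (𝓡 n) (𝓡 n) φ.symm x v))

variable [IsManifold (𝓡 n) ∞ M] [Bundle.RiemannianBundle (fun p : M => TangentSpace (𝓡 n) p)]

/-- The Gram matrix `(⟨∂/∂xᵢ, ∂/∂xⱼ⟩)ᵢⱼ` of the Riemannian metric in the chart `φ`. -/
def chartMetric (φ : OpenPartialHomeomorph M (EuclideanSpace ℝ (Fin n)))
    (x : EuclideanSpace ℝ (Fin n)) : Matrix (Fin n) (Fin n) ℝ :=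
  Matrix.of fun i j => inner ℝ (coordVec φ i x) (coordVec φ j x)

/-- `φ` is a smooth chart of `M` whose coordinates are orthogonal. -/
structure IsOrthogonalChart (φ : OpenPartialHomeomorph M (EuclideanSpace ℝ (Fin n))) : Prop where
  smooth : φ ∈ IsManifold.maximalAtlas (𝓡 n) ∞ M
  orthogonal : ∀ x ∈ φ.target, ∀ i j : Fin n, i ≠ j →
    inner ℝ (coordVec φ i x) (coordVec φ j x) = 0

/-- `aᵢ = √⟨∂/∂xᵢ, ∂/∂xᵢ⟩`. -/
def scaleFactor (φ : OpenPartialHomeomorph M (EuclideanSpace ℝ (Fin n))) (i : Fin n)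
    (x : EuclideanSpace ℝ (Fin n)) : ℝ :=
  √(inner ℝ (coordVec φ i x) (coordVec φ i x))

/-- The associated frame `eᵢ = (1 / aᵢ) ∂/∂xᵢ`. -/
def frameVec (φ : OpenPartialHomeomorph M (EuclideanSpace ℝ (Fin n))) (i : Fin n)
    (x : EuclideanSpace ℝ (Fin n)) : TangentSpace (𝓡 n) (φ.symm x) :=
  (scaleFactor φ i x)⁻¹ • coordVec φ i x

/-- The vector `eᵢ` of the associated frame, read in the chart `φ`. -/
def frameCoord (φ : OpenPartialHomeomorph M (EuclideanSpace ℝ (Fin n))) (i : Fin n)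
    (x : EuclideanSpace ℝ (Fin n)) : EuclideanSpace ℝ (Fin n) :=
  (scaleFactor φ i x)⁻¹ • basisVec i

/-- `R_{ijkl} = ⟨R_{eᵢeⱼ} eₖ, eₗ⟩` in the frame associated to `φ`. -/
def frameCurv (φ : OpenPartialHomeomorph M (EuclideanSpace ℝ (Fin n)))
    (x : EuclideanSpace ℝ (Fin n)) (i j k l : Fin n) : ℝ :=
  riemann (chartMetric φ) x
    (frameCoord φ i x) (frameCoord φ j x) (frameCoord φ k x) (frameCoord φ l x)

/-- The components `a_{ij} = ⟨J eᵢ, eⱼ⟩` of `J` in the frame associated to `φ`, so that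
`J eᵢ = ∑ⱼ a_{ij} eⱼ`. -/
def frameComplex (J : ∀ p : M, TangentSpace (𝓡 n) p →L[ℝ] TangentSpace (𝓡 n) p)
    (φ : OpenPartialHomeomorph M (EuclideanSpace ℝ (Fin n)))
    (x : EuclideanSpace ℝ (Fin n)) (i j : Fin n) : ℝ :=
  inner ℝ (J (φ.symm x) (frameVec φ i x)) (frameVec φ j x)

/-- The Riemannian manifold `M` with the complex-structure tensor `J` is Kähler: `J` is a smooth
orthogonal endomorphism field with `J² = -1` and `∇J = 0`, that is, `∇_X (J Y) = J (∇_X Y)` for all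
vector fields (tested in every smooth chart). -/
structure IsKahler (J : ∀ p : M, TangentSpace (𝓡 n) p →L[ℝ] TangentSpace (𝓡 n) p) : Prop where
  smooth : ContMDiff (𝓡 n)
    ((𝓡 n).prod 𝓘(ℝ, EuclideanSpace ℝ (Fin n) →L[ℝ] EuclideanSpace ℝ (Fin n))) ∞
    (fun p => Bundle.TotalSpace.mk' (EuclideanSpace ℝ (Fin n) →L[ℝ] EuclideanSpace ℝ (Fin n))
      (E := fun p : M => TangentSpace (𝓡 n) p →L[ℝ] TangentSpace (𝓡 n) p) p (J p))
  sq_eq_neg : ∀ (p : M) (v : TangentSpace (𝓡 n) p), J p (J p v) = -v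
  isometry : ∀ (p : M) (v w : TangentSpace (𝓡 n) p), inner ℝ (J p v) (J p w) = inner ℝ v w
  parallel : ∀ φ ∈ IsManifold.maximalAtlas (𝓡 n) ∞ M,
    ∀ X Y : EuclideanSpace ℝ (Fin n) → EuclideanSpace ℝ (Fin n),
    ContDiffOn ℝ ∞ X φ.target → ContDiffOn ℝ ∞ Y φ.target → ∀ x ∈ φ.target,
      covDeriv (chartMetric φ) X (fun y => chartEndo J φ y (Y y)) x
        = chartEndo J φ x (covDeriv (chartMetric φ) X Y x)

end Manifold

end OrthCoord

end

/-!
In an orthonormal frame, skew-symmetric endomorphisms are bivectors of `ℝ⁴`, acted on by the Hodge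
star `⋆`. Since `a ⋆a = -pf(a)` for skew-symmetric `a`, and `J² = -1`, the complex structure
satisfies `⋆J = p J` with `p = pf(J) = ±1`: it is self-dual or anti-self-dual. As `∇J = 0`, the
curvature operators `R_{ij}` commute with `J`, and commuting means that the `p`-self-dual part of
`R_{ij}` is proportional to `J`. By the pair symmetry of the curvature, its block on the
`p`-self-dual bivectors is therefore a symmetric matrix of rank one, `c v vᵀ` with the unit vector
`v = (a₁₂, a₁₃, a₁₄)`, and its trace `c` is `r / 2`.

In orthogonal coordinates `R_{ijkl}` vanishes for distinct `i, j, k, l`, so the diagonal entries of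
the block are exactly `R₁₂₁₂ + R₃₄₃₄`, `R₁₃₁₃ + R₂₄₂₄` and `R₁₄₁₄ + R₂₃₂₃`.
-/

noncomputable section

namespace OrthCoord

section Connection

open Topology

variable {E F : Type*} [NormedAddCommGroup E] [NormedSpace ℝ E]
  [NormedAddCommGroup F] [NormedSpace ℝ F]

/-- The covariant derivative `∇_u Z` of the connection `d + Γ` on the trivial bundle over `E` with
fibre `F`, in a constant direction `u`. -/
def covDerivConst (Γ : E → E →L[ℝ] F →L[ℝ] F) (u : E) (Z : E → F) (x : E) : F :=
  fderiv ℝ Z x u + Γ x u (Z x)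

/-- The curvature `R_{uv} = ∇_v ∇_u - ∇_u ∇_v` (for constant `u`, `v`) of the connection `d + Γ`,
with the sign convention of `curvOp`. -/
def curvForm (Γ : E → E →L[ℝ] F →L[ℝ] F) (x u v : E) : F →L[ℝ] F :=
  fderiv ℝ Γ x v u - fderiv ℝ Γ x u v + (Γ x v ∘L Γ x u - Γ x u ∘L Γ x v)

/-- The covariant derivative of the field of bilinear forms `G` vanishes at `x` for the connection
`d + Γ`. -/
def IsParallelAt (Γ : E → E →L[ℝ] F →L[ℝ] F) (G : E → F →L[ℝ] F →L[ℝ] ℝ) (x : E) : Prop :=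
  ∀ u v w, fderiv ℝ G x u v w = G x (Γ x u v) w + G x v (Γ x u w)

variable {Γ : E → E →L[ℝ] F →L[ℝ] F} {G : E → F →L[ℝ] F →L[ℝ] ℝ} {x : E}

lemma fderiv_clm_apply_const {f : E → F} (hf : DifferentiableAt ℝ (fderiv ℝ f) x) (u v : E) :
    fderiv ℝ (fun y => fderiv ℝ f y v) x u = fderiv ℝ (fderiv ℝ f) x u v := by
  rw [(hf.hasFDerivAt.clm_apply (hasFDerivAt_const v x)).fderiv]
  simp

lemma fderiv_bilin_apply {V W : Type*} [NormedAddCommGroup V] [NormedSpace ℝ V]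
    [NormedAddCommGroup W] [NormedSpace ℝ W] {B : E → V →L[ℝ] F →L[ℝ] W}
    (hB : DifferentiableAt ℝ B x) (u : E) (v : V) (w : F) :
    fderiv ℝ (fun y => B y v w) x u = fderiv ℝ B x u v w := by
  rw [((hB.hasFDerivAt.clm_apply (hasFDerivAt_const v x)).clm_apply (hasFDerivAt_const w x)).fderiv]
  simp only [ContinuousLinearMap.comp_zero, zero_add, ContinuousLinearMap.flip_apply]

lemma curvForm_antisymm (u v : E) : curvForm Γ x v u = -curvForm Γ x u v := by
  unfold curvForm
  abel

lemma curvForm_smul_left (a : ℝ) (u v : E) :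
    curvForm Γ x (a • u) v = a • curvForm Γ x u v := by
  have hfd : fderiv ℝ Γ x (a • u) v = a • fderiv ℝ Γ x u v := by
    rw [ContinuousLinearMap.map_smul, smul_apply]
  rw [curvForm, hfd, ContinuousLinearMap.map_smul, ContinuousLinearMap.map_smul,
    ContinuousLinearMap.comp_smul, ContinuousLinearMap.smul_comp, ← smul_sub, ← smul_sub,
    ← smul_add, curvForm]

lemma curvForm_smul_right (b : ℝ) (u v : E) :
    curvForm Γ x u (b • v) = b • curvForm Γ x u v := by
  rw [curvForm_antisymm, curvForm_smul_left, curvForm_antisymm u v, smul_neg, neg_neg]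

lemma differentiableAt_covDerivConst (hΓ : DifferentiableAt ℝ Γ x) {Z : E → F}
    (hZ : ContDiffAt ℝ 2 Z x) (u : E) : DifferentiableAt ℝ (covDerivConst Γ u Z) x := by
  have hdZ : DifferentiableAt ℝ (fderiv ℝ Z) x :=
    (hZ.fderiv_right (m := 1) (by norm_num)).differentiableAt one_ne_zero
  have hZ' : DifferentiableAt ℝ Z x := hZ.differentiableAt two_ne_zero
  unfold covDerivConst
  fun_prop

lemma covDerivConst_covDerivConst (hΓ : DifferentiableAt ℝ Γ x) {Z : E → F}
    (hZ : ContDiffAt ℝ 2 Z x) (u v : E) :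
    covDerivConst Γ u (covDerivConst Γ v Z) x =
      fderiv ℝ (fderiv ℝ Z) x u v + fderiv ℝ Γ x u v (Z x) + Γ x v (fderiv ℝ Z x u)
        + Γ x u (fderiv ℝ Z x v) + Γ x u (Γ x v (Z x)) := by
  have hdZ : HasFDerivAt (fderiv ℝ Z) (fderiv ℝ (fderiv ℝ Z) x) x :=
    ((hZ.fderiv_right (m := 1) (by norm_num)).differentiableAt one_ne_zero).hasFDerivAt
  have hZ' : HasFDerivAt Z (fderiv ℝ Z x) x := (hZ.differentiableAt two_ne_zero).hasFDerivAt
  have hD : HasFDerivAt (covDerivConst Γ v Z) _ x := (hdZ.clm_apply (hasFDerivAt_const v x)).add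
    ((hΓ.hasFDerivAt.clm_apply (hasFDerivAt_const v x)).clm_apply hZ')
  rw [covDerivConst, hD.fderiv]
  simp only [covDerivConst, ContinuousLinearMap.comp_zero, zero_apply, add_apply,
    ContinuousLinearMap.flip_apply, ContinuousLinearMap.comp_apply, ContinuousLinearMap.map_add]
  abel

lemma covDerivConst_comm (hΓ : DifferentiableAt ℝ Γ x) {Z : E → F} (hZ : ContDiffAt ℝ 2 Z x)
    (u v : E) :
    covDerivConst Γ v (covDerivConst Γ u Z) x - covDerivConst Γ u (covDerivConst Γ v Z) x =
      curvForm Γ x u v (Z x) := by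
  have hsymm : fderiv ℝ (fderiv ℝ Z) x u v = fderiv ℝ (fderiv ℝ Z) x v u :=
    (hZ.isSymmSndFDerivAt (by simp)).eq u v
  rw [covDerivConst_covDerivConst hΓ hZ, covDerivConst_covDerivConst hΓ hZ, hsymm]
  simp only [curvForm, add_apply, sub_apply, ContinuousLinearMap.comp_apply]
  abel

lemma IsParallelAt.fderiv_apply (hG : IsParallelAt Γ G x) (hGd : DifferentiableAt ℝ G x)
    {Z W : E → F} (hZ : DifferentiableAt ℝ Z x) (hW : DifferentiableAt ℝ W x) (u : E) :
    fderiv ℝ (fun y => G y (Z y) (W y)) x u =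
      G x (covDerivConst Γ u Z x) (W x) + G x (Z x) (covDerivConst Γ u W x) := by
  rw [((hGd.hasFDerivAt.clm_apply hZ.hasFDerivAt).clm_apply hW.hasFDerivAt).fderiv]
  simp only [covDerivConst, hG u, ContinuousLinearMap.flip_add, add_apply,
    ContinuousLinearMap.comp_apply, ContinuousLinearMap.flip_apply, map_add]
  ring

/-- `u (v (G (w, z)))` is symmetric in `u` and `v`; expanding it with the product rule leaves only
the curvature terms in the difference. -/
lemma IsParallelAt.curvForm_skew (hG : ∀ᶠ y in 𝓝 x, IsParallelAt Γ G y)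
    (hΓ : DifferentiableAt ℝ Γ x) (hG2 : ContDiffAt ℝ 2 G x) (u v : E) (w z : F) :
    G x (curvForm Γ x u v w) z = -G x w (curvForm Γ x u v z) := by
  set f : E → ℝ := fun y => G y w z
  have hf : ContDiffAt ℝ 2 f x := by unfold f; fun_prop
  have hGd : ∀ᶠ y in 𝓝 x, DifferentiableAt ℝ G y :=
    (hG2.eventually (by simp)).mono fun y hy => hy.differentiableAt two_ne_zero
  have hconst (w : F) (v : E) : DifferentiableAt ℝ (covDerivConst Γ v fun _ => w) x :=
    differentiableAt_covDerivConst hΓ contDiffAt_const v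
  have hfirst (v : E) : (fun y => fderiv ℝ f y v) =ᶠ[𝓝 x] fun y =>
      G y (covDerivConst Γ v (fun _ => w) y) z + G y w (covDerivConst Γ v (fun _ => z) y) := by
    filter_upwards [hG, hGd] with y hy hyd using
      hy.fderiv_apply hyd (differentiableAt_const w) (differentiableAt_const z) v
  have hsecond (u v : E) : fderiv ℝ (fderiv ℝ f) x u v =
      G x (covDerivConst Γ u (covDerivConst Γ v fun _ => w) x) z
      + G x (covDerivConst Γ v (fun _ => w) x) (covDerivConst Γ u (fun _ => z) x)
      + (G x (covDerivConst Γ u (fun _ => w) x) (covDerivConst Γ v (fun _ => z) x)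
      + G x w (covDerivConst Γ u (covDerivConst Γ v fun _ => z) x)) := by
    have hGx := hGd.self_of_nhds
    rw [← fderiv_clm_apply_const
      ((hf.fderiv_right (m := 1) (by norm_num)).differentiableAt one_ne_zero), (hfirst v).fderiv_eq,
      fderiv_fun_add ((hGx.clm_apply (hconst w v)).clm_apply (differentiableAt_const z))
        ((hGx.clm_apply (differentiableAt_const w)).clm_apply (hconst z v)),
      add_apply, hG.self_of_nhds.fderiv_apply hGx (hconst w v) (differentiableAt_const z),
      hG.self_of_nhds.fderiv_apply hGx (differentiableAt_const w) (hconst z v)]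
  have hsymm := (hf.isSymmSndFDerivAt (by simp)).eq v u
  rw [hsecond, hsecond] at hsymm
  rw [← covDerivConst_comm hΓ (contDiffAt_const (c := w)),
    ← covDerivConst_comm hΓ (contDiffAt_const (c := z)), map_sub, map_sub, sub_apply]
  linarith

end Connection

section TorsionFree

open Topology

variable {E : Type*} [NormedAddCommGroup E] [NormedSpace ℝ E] {Γ : E → E →L[ℝ] E →L[ℝ] E} {x : E}

lemma fderiv_symm_of_eventually_symm (hsymm : ∀ᶠ y in 𝓝 x, ∀ u v, Γ y u v = Γ y v u)
    (hΓ : DifferentiableAt ℝ Γ x) (u v w : E) :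
    fderiv ℝ Γ x u v w = fderiv ℝ Γ x u w v := by
  rw [← fderiv_bilin_apply hΓ, ← fderiv_bilin_apply hΓ,
    Filter.EventuallyEq.fderiv_eq (hsymm.mono fun y hy => hy v w)]

lemma curvForm_bianchi (hsymm : ∀ᶠ y in 𝓝 x, ∀ u v, Γ y u v = Γ y v u)
    (hΓ : DifferentiableAt ℝ Γ x) (u v w : E) :
    curvForm Γ x u v w + curvForm Γ x v w u + curvForm Γ x w u v = 0 := by
  have hd := fderiv_symm_of_eventually_symm hsymm hΓ
  have hs := hsymm.self_of_nhds
  simp only [curvForm, add_apply, sub_apply, ContinuousLinearMap.comp_apply]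
  rw [hd v u w, hd u v w, hd w v u, hs u w, hs v w, hs v u]
  abel

end TorsionFree

lemma pair_symm_of_bianchi {V K : Type*} [Field K] [CharZero K] {T : V → V → V → V → K}
    (hleft : ∀ u v w z, T v u w z = -T u v w z) (hright : ∀ u v w z, T u v z w = -T u v w z)
    (hbianchi : ∀ u v w z, T u v w z + T v w u z + T w u v z = 0) (u v w z : V) :
    T u v w z = T w z u v := by
  have hsum : 2 * T u v w z = 2 * T w z u v := by
    linear_combination hbianchi u v w z + hbianchi v w z u - hbianchi w z u v - hbianchi z u v w
      - hright v w u z + hright u v w z - hright w z u v + hright z u v w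
      + hright u w v z - hleft u w v z + hright v z w u - hleft v z w u
  exact mul_left_cancel₀ two_ne_zero hsum

section Coordinates

open Topology

variable {n : ℕ} {g : EuclideanSpace ℝ (Fin n) → Matrix (Fin n) (Fin n) ℝ}
  {U : Set (EuclideanSpace ℝ (Fin n))} {x : EuclideanSpace ℝ (Fin n)}

/-- A smooth pseudo-Riemannian metric, given by its Gram matrix `g`, on the open set `U ⊆ ℝⁿ`. -/
structure IsMetricOn (g : EuclideanSpace ℝ (Fin n) → Matrix (Fin n) (Fin n) ℝ)
    (U : Set (EuclideanSpace ℝ (Fin n))) : Prop where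
  isOpen : IsOpen U
  contDiffOn : ∀ i j, ContDiffOn ℝ ∞ (fun y => g y i j) U
  isSymm : ∀ y ∈ U, (g y).IsSymm
  isUnit_det : ∀ y ∈ U, IsUnit (g y).det

/-- The Levi-Civita connection of `g` as the field of bilinear maps `Γ` with `∇ = d + Γ`. -/
def christoffelForm (g : EuclideanSpace ℝ (Fin n) → Matrix (Fin n) (Fin n) ℝ)
    (y : EuclideanSpace ℝ (Fin n)) :
    EuclideanSpace ℝ (Fin n) →L[ℝ] EuclideanSpace ℝ (Fin n) →L[ℝ] EuclideanSpace ℝ (Fin n) :=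
  ∑ k, ∑ i, ∑ j, christoffel g k i j y •
    (EuclideanSpace.proj i : EuclideanSpace ℝ (Fin n) →L[ℝ] ℝ).smulRight
      ((EuclideanSpace.proj j : EuclideanSpace ℝ (Fin n) →L[ℝ] ℝ).smulRight (basisVec k))

/-- `metricInner g` as a field of continuous bilinear forms. -/
def metricForm (g : EuclideanSpace ℝ (Fin n) → Matrix (Fin n) (Fin n) ℝ)
    (y : EuclideanSpace ℝ (Fin n)) :
    EuclideanSpace ℝ (Fin n) →L[ℝ] EuclideanSpace ℝ (Fin n) →L[ℝ] ℝ :=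
  ∑ i, ∑ j, g y i j •
    (EuclideanSpace.proj i : EuclideanSpace ℝ (Fin n) →L[ℝ] ℝ).smulRight
      (EuclideanSpace.proj j : EuclideanSpace ℝ (Fin n) →L[ℝ] ℝ)

lemma basisVec_apply (i k : Fin n) : basisVec i k = if k = i then (1 : ℝ) else 0 := by
  simp [basisVec]

lemma sum_smul_basisVec (v : EuclideanSpace ℝ (Fin n)) : ∑ i, v i • basisVec i = v := by
  ext k
  simp [basisVec_apply]

lemma metricForm_apply (y u v : EuclideanSpace ℝ (Fin n)) :
    metricForm g y u v = metricInner g y u v := by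
  simp [metricForm, metricInner, mul_assoc]

lemma metricForm_symm (hg : (g x).IsSymm) (u v : EuclideanSpace ℝ (Fin n)) :
    metricForm g x u v = metricForm g x v u := by
  rw [metricForm_apply, metricForm_apply, metricInner, metricInner, Finset.sum_comm]
  refine Finset.sum_congr rfl fun i _ => Finset.sum_congr rfl fun j _ => ?_
  rw [hg.apply, mul_right_comm]

lemma christoffelForm_apply (y u v : EuclideanSpace ℝ (Fin n)) (k : Fin n) :
    christoffelForm g y u v k = ∑ i, ∑ j, christoffel g k i j y * u i * v j := by
  simp [christoffelForm, mul_assoc, basisVec_apply, Finset.sum_ite_irrel]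

lemma christoffelForm_basisVec (y : EuclideanSpace ℝ (Fin n)) (i j k : Fin n) :
    christoffelForm g y (basisVec i) (basisVec j) k = christoffel g k i j y := by
  simp [christoffelForm_apply, basisVec_apply]

lemma covDeriv_eq (X Y : EuclideanSpace ℝ (Fin n) → EuclideanSpace ℝ (Fin n))
    (x : EuclideanSpace ℝ (Fin n)) :
    covDeriv g X Y x = covDerivConst (christoffelForm g) (X x) Y x := by
  ext k
  simp [covDeriv, covDerivConst, christoffelForm_apply]

lemma covDeriv_congr {X Y Z : EuclideanSpace ℝ (Fin n) → EuclideanSpace ℝ (Fin n)}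
    (h : Y =ᶠ[𝓝 x] Z) : covDeriv g X Y x = covDeriv g X Z x := by
  rw [covDeriv, covDeriv, h.fderiv_eq, h.eq_of_nhds]

lemma curvOp_const (hΓ : DifferentiableAt ℝ (christoffelForm g) x)
    {Z : EuclideanSpace ℝ (Fin n) → EuclideanSpace ℝ (Fin n)} (hZ : ContDiffAt ℝ 2 Z x)
    (u v : EuclideanSpace ℝ (Fin n)) :
    curvOp g (fun _ => u) (fun _ => v) Z x = curvForm (christoffelForm g) x u v (Z x) := by
  have hcov (u : EuclideanSpace ℝ (Fin n)) :
      covDeriv g (fun _ => u) Z = covDerivConst (christoffelForm g) u Z :=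
    funext fun y => covDeriv_eq _ _ y
  have hbracket : covDeriv g (VectorField.lieBracket ℝ (fun _ => u) fun _ => v) Z x = 0 := by
    simp [covDeriv_eq, covDerivConst, VectorField.lieBracket]
  rw [← covDerivConst_comm hΓ hZ, curvOp, hbracket, hcov, hcov, covDeriv_eq, covDeriv_eq]
  abel

/-- The instance search of `ContDiffOn.smul_const` times out on spaces of bilinear maps. -/
lemma contDiffOn_smul_const {E F : Type*} [NormedAddCommGroup E] [NormedSpace ℝ E]
    [NormedAddCommGroup F] [NormedSpace ℝ F] {m : WithTop ℕ∞} {s : Set E} {f : E → ℝ}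
    (hf : ContDiffOn ℝ m f s) (c : F) : ContDiffOn ℝ m (fun y => f y • c) s :=
  hf.smul contDiffOn_const

lemma partialDeriv_congr {f h : EuclideanSpace ℝ (Fin n) → ℝ} (hfh : f =ᶠ[𝓝 x] h) (i : Fin n) :
    partialDeriv i f x = partialDeriv i h x := by
  rw [partialDeriv, partialDeriv, hfh.fderiv_eq]

lemma fderiv_apply_eq_sum (f : EuclideanSpace ℝ (Fin n) → ℝ) (x u : EuclideanSpace ℝ (Fin n)) :
    fderiv ℝ f x u = ∑ i, partialDeriv i f x * u i := by
  conv_lhs => rw [← sum_smul_basisVec u, map_sum]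
  exact Finset.sum_congr rfl fun i _ => by rw [map_smul, smul_eq_mul, mul_comm, partialDeriv]

lemma contDiffOn_det {E ι : Type*} [NormedAddCommGroup E] [NormedSpace ℝ E] [Fintype ι]
    [DecidableEq ι] {m : WithTop ℕ∞} {s : Set E} {A : E → Matrix ι ι ℝ}
    (hA : ∀ i j, ContDiffOn ℝ m (fun y => A y i j) s) :
    ContDiffOn ℝ m (fun y => (A y).det) s := by
  simp only [Matrix.det_apply']
  exact ContDiffOn.sum fun σ _ => contDiffOn_const.mul
    (contDiffOn_prod fun i _ => hA (σ i) i)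

namespace IsMetricOn

lemma sum_mul_christoffel (hg : IsMetricOn g U) (hx : x ∈ U) (l i j : Fin n) :
    ∑ k, g x l k * christoffel g k i j x =
      (1 / 2 : ℝ) * (partialDeriv i (fun y => g y j l) x + partialDeriv j (fun y => g y i l) x
        - partialDeriv l (fun y => g y i j) x) := by
  set c : Fin n → ℝ := fun l => partialDeriv i (fun y => g y j l) x
    + partialDeriv j (fun y => g y i l) x - partialDeriv l (fun y => g y i j) x
  have hΓ : (fun k => christoffel g k i j x) = (1 / 2 : ℝ) • ((g x)⁻¹.mulVec c) := rfl
  change (g x).mulVec (fun k => christoffel g k i j x) l = _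
  rw [hΓ, Matrix.mulVec_smul, Matrix.mulVec_mulVec, Matrix.mul_nonsing_inv _ (hg.isUnit_det x hx),
    Matrix.one_mulVec]
  rfl

lemma differentiableAt (hg : IsMetricOn g U) (hx : x ∈ U) (i j : Fin n) :
    DifferentiableAt ℝ (fun y => g y i j) x :=
  ((hg.contDiffOn i j).contDiffAt (hg.isOpen.mem_nhds hx)).differentiableAt (by simp)

lemma contDiffOn_metricForm (hg : IsMetricOn g U) : ContDiffOn ℝ ∞ (metricForm g) U := by
  unfold metricForm
  exact ContDiffOn.sum fun i _ => ContDiffOn.sum fun j _ =>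
    contDiffOn_smul_const (hg.contDiffOn i j) _

lemma fderiv_metricForm (hg : IsMetricOn g U) (hx : x ∈ U) (u v w : EuclideanSpace ℝ (Fin n)) :
    fderiv ℝ (metricForm g) x u v w =
      ∑ i, ∑ j, ∑ l, partialDeriv i (fun y => g y j l) x * u i * v j * w l := by
  have hd : DifferentiableAt ℝ (metricForm g) x :=
    (hg.contDiffOn_metricForm.contDiffAt (hg.isOpen.mem_nhds hx)).differentiableAt (by simp)
  have hval : HasFDerivAt (fun y => metricForm g y v w)
      (∑ j, ∑ l, (v j * w l) • fderiv ℝ (fun y => g y j l) x) x := by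
    simp only [metricForm_apply, metricInner, mul_assoc]
    exact HasFDerivAt.fun_sum fun j _ => HasFDerivAt.fun_sum fun l _ =>
      (hg.differentiableAt hx j l).hasFDerivAt.mul_const (v j * w l)
  rw [← fderiv_bilin_apply hd, hval.fderiv]
  simp only [sum_apply, smul_apply, fderiv_apply_eq_sum, smul_eq_mul, Finset.mul_sum]
  rw [Finset.sum_comm_cycle]
  exact Finset.sum_congr rfl fun i _ => Finset.sum_congr rfl fun j _ =>
    Finset.sum_congr rfl fun l _ => by ring

/-- The Koszul formula for constant vector fields. -/
lemma metricForm_christoffelForm (hg : IsMetricOn g U) (hx : x ∈ U)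
    (u v w : EuclideanSpace ℝ (Fin n)) :
    metricForm g x w (christoffelForm g x u v) =
      (fderiv ℝ (metricForm g) x u v w + fderiv ℝ (metricForm g) x v u w
        - fderiv ℝ (metricForm g) x w u v) / 2 := by
  have hlower : metricForm g x w (christoffelForm g x u v) =
      ∑ l, ∑ i, ∑ j, (∑ k, g x l k * christoffel g k i j x) * u i * v j * w l := by
    rw [metricForm_apply, metricInner]
    refine Finset.sum_congr rfl fun l _ => ?_
    simp only [christoffelForm_apply, Finset.mul_sum, Finset.sum_mul]
    rw [Finset.sum_comm]
    refine Finset.sum_congr rfl fun i _ => ?_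
    rw [Finset.sum_comm]
    exact Finset.sum_congr rfl fun j _ => Finset.sum_congr rfl fun k _ => by ring
  have hv : fderiv ℝ (metricForm g) x v u w =
      ∑ l, ∑ i, ∑ j, partialDeriv j (fun y => g y i l) x * u i * v j * w l := by
    rw [hg.fderiv_metricForm hx, Finset.sum_comm_cycle]
    exact Finset.sum_congr rfl fun l _ => Finset.sum_comm.trans <| Finset.sum_congr rfl fun i _ =>
      Finset.sum_congr rfl fun j _ => by ring
  have hu : fderiv ℝ (metricForm g) x u v w =
      ∑ l, ∑ i, ∑ j, partialDeriv i (fun y => g y j l) x * u i * v j * w l := by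
    rw [hg.fderiv_metricForm hx, Finset.sum_comm_cycle]
  rw [hlower, hu, hv, hg.fderiv_metricForm hx]
  simp only [hg.sum_mul_christoffel hx, ← Finset.sum_add_distrib, ← Finset.sum_sub_distrib,
    Finset.sum_div]
  exact Finset.sum_congr rfl fun l _ => Finset.sum_congr rfl fun i _ =>
    Finset.sum_congr rfl fun j _ => by ring

lemma partialDeriv_symm (hg : IsMetricOn g U) (hx : x ∈ U) (m i j : Fin n) :
    partialDeriv m (fun y => g y i j) x = partialDeriv m (fun y => g y j i) x := by
  refine partialDeriv_congr ?_ m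
  filter_upwards [hg.isOpen.mem_nhds hx] with y hy using (hg.isSymm y hy).apply j i

lemma fderiv_metricForm_symm (hg : IsMetricOn g U) (hx : x ∈ U)
    (u v w : EuclideanSpace ℝ (Fin n)) :
    fderiv ℝ (metricForm g) x u v w = fderiv ℝ (metricForm g) x u w v := by
  rw [hg.fderiv_metricForm hx, hg.fderiv_metricForm hx]
  refine Finset.sum_congr rfl fun i _ => Finset.sum_comm.trans <|
    Finset.sum_congr rfl fun l _ => Finset.sum_congr rfl fun j _ => ?_
  rw [hg.partialDeriv_symm hx i j l]
  ring

lemma isParallelAt (hg : IsMetricOn g U) (hx : x ∈ U) :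
    IsParallelAt (christoffelForm g) (metricForm g) x := by
  intro u v w
  rw [metricForm_symm (hg.isSymm x hx) _ w, hg.metricForm_christoffelForm hx,
    hg.metricForm_christoffelForm hx, hg.fderiv_metricForm_symm hx u w v,
    hg.fderiv_metricForm_symm hx w u v, hg.fderiv_metricForm_symm hx v u w]
  ring

lemma christoffelForm_symm (hg : IsMetricOn g U) (hx : x ∈ U)
    (u v : EuclideanSpace ℝ (Fin n)) :
    christoffelForm g x u v = christoffelForm g x v u := by
  have hsymm (k i j : Fin n) : christoffel g k i j x = christoffel g k j i x := by
    unfold christoffel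
    congr 1
    refine Finset.sum_congr rfl fun l _ => ?_
    rw [hg.partialDeriv_symm hx l i j, add_comm (partialDeriv i _ x)]
  ext k
  rw [christoffelForm_apply, christoffelForm_apply, Finset.sum_comm]
  refine Finset.sum_congr rfl fun i _ => Finset.sum_congr rfl fun j _ => ?_
  rw [hsymm, mul_right_comm]

lemma contDiffOn_inv_apply (hg : IsMetricOn g U) (k l : Fin n) :
    ContDiffOn ℝ ∞ (fun y => (g y)⁻¹ k l) U := by
  have hadj : ContDiffOn ℝ ∞ (fun y => (g y).adjugate k l) U := by
    simp only [Matrix.adjugate_apply]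
    refine contDiffOn_det fun i j => ?_
    rcases eq_or_ne i l with rfl | hi
    · simpa only [Matrix.updateRow_self] using contDiffOn_const
    · simpa only [Matrix.updateRow_ne hi] using hg.contDiffOn i j
  have hinv (y : EuclideanSpace ℝ (Fin n)) :
      (g y)⁻¹ k l = ((g y).det)⁻¹ * (g y).adjugate k l := by
    simp [Matrix.inv_def]
  simp only [hinv]
  exact ((contDiffOn_det hg.contDiffOn).inv fun y hy => (hg.isUnit_det y hy).ne_zero).mul hadj

lemma contDiffOn_christoffelForm (hg : IsMetricOn g U) :
    ContDiffOn ℝ ∞ (christoffelForm g) U := by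
  have hpartial (m i j : Fin n) : ContDiffOn ℝ ∞ (partialDeriv m fun y => g y i j) U :=
    ((hg.contDiffOn i j).fderiv_of_isOpen hg.isOpen (by simp)).clm_apply contDiffOn_const
  have hΓ (k i j : Fin n) : ContDiffOn ℝ ∞ (christoffel g k i j) U :=
    contDiffOn_const.mul (ContDiffOn.sum fun l _ => (hg.contDiffOn_inv_apply k l).mul
      (((hpartial i j l).add (hpartial j i l)).sub (hpartial l i j)))
  unfold christoffelForm
  exact ContDiffOn.sum fun k _ => ContDiffOn.sum fun i _ => ContDiffOn.sum fun j _ =>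
    contDiffOn_smul_const (hΓ k i j) _

lemma differentiableAt_christoffelForm (hg : IsMetricOn g U) (hx : x ∈ U) :
    DifferentiableAt ℝ (christoffelForm g) x :=
  (hg.contDiffOn_christoffelForm.contDiffAt (hg.isOpen.mem_nhds hx)).differentiableAt (by simp)

lemma riemann_eq (hg : IsMetricOn g U) (hx : x ∈ U) (u v w z : EuclideanSpace ℝ (Fin n)) :
    riemann g x u v w z = metricForm g x (curvForm (christoffelForm g) x u v w) z := by
  rw [riemann, curvOp_const (hg.differentiableAt_christoffelForm hx) contDiffAt_const,
    metricForm_apply]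

lemma riemann_antisymm_left (hg : IsMetricOn g U) (hx : x ∈ U)
    (u v w z : EuclideanSpace ℝ (Fin n)) : riemann g x v u w z = -riemann g x u v w z := by
  rw [hg.riemann_eq hx, hg.riemann_eq hx, curvForm_antisymm,
    neg_apply (curvForm _ _ _ _), ContinuousLinearMap.map_neg₂]

lemma curvForm_skew (hg : IsMetricOn g U) (hx : x ∈ U) (u v w z : EuclideanSpace ℝ (Fin n)) :
    metricForm g x (curvForm (christoffelForm g) x u v w) z =
      -metricForm g x w (curvForm (christoffelForm g) x u v z) := by
  have hparallel : ∀ᶠ y in 𝓝 x, IsParallelAt (christoffelForm g) (metricForm g) y := by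
    filter_upwards [hg.isOpen.mem_nhds hx] with y hy using hg.isParallelAt hy
  have hG : ContDiffAt ℝ 2 (metricForm g) x :=
    (hg.contDiffOn_metricForm.contDiffAt (hg.isOpen.mem_nhds hx)).of_le ENat.LEInfty.out
  exact IsParallelAt.curvForm_skew hparallel (hg.differentiableAt_christoffelForm hx) hG u v w z

lemma riemann_antisymm_right (hg : IsMetricOn g U) (hx : x ∈ U)
    (u v w z : EuclideanSpace ℝ (Fin n)) : riemann g x u v z w = -riemann g x u v w z := by
  rw [hg.riemann_eq hx, hg.riemann_eq hx, hg.curvForm_skew hx, metricForm_symm (hg.isSymm x hx)]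

lemma riemann_bianchi (hg : IsMetricOn g U) (hx : x ∈ U) (u v w z : EuclideanSpace ℝ (Fin n)) :
    riemann g x u v w z + riemann g x v w u z + riemann g x w u v z = 0 := by
  have hsymm : ∀ᶠ y in 𝓝 x, ∀ u v, christoffelForm g y u v = christoffelForm g y v u := by
    filter_upwards [hg.isOpen.mem_nhds hx] with y hy using hg.christoffelForm_symm hy
  rw [hg.riemann_eq hx, hg.riemann_eq hx, hg.riemann_eq hx, ← add_apply, ← map_add, ← add_apply,
    ← map_add, curvForm_bianchi hsymm (hg.differentiableAt_christoffelForm hx), map_zero,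
    zero_apply]

lemma riemann_pair_symm (hg : IsMetricOn g U) (hx : x ∈ U)
    (u v w z : EuclideanSpace ℝ (Fin n)) : riemann g x u v w z = riemann g x w z u v :=
  pair_symm_of_bianchi (hg.riemann_antisymm_left hx) (hg.riemann_antisymm_right hx)
    (hg.riemann_bianchi hx) u v w z

lemma riemann_smul (hg : IsMetricOn g U) (hx : x ∈ U) (a b c d : ℝ)
    (u v w z : EuclideanSpace ℝ (Fin n)) :
    riemann g x (a • u) (b • v) (c • w) (d • z) = a * b * c * d * riemann g x u v w z := by
  rw [hg.riemann_eq hx, hg.riemann_eq hx, curvForm_smul_left, curvForm_smul_right]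
  simp only [smul_apply, map_smul, smul_eq_mul]
  ring

end IsMetricOn

section Diagonal

lemma inv_apply_of_isDiag {ι K : Type*} [Fintype ι] [DecidableEq ι] [Field K] {A : Matrix ι ι K}
    (hA : A.IsDiag) (hdet : IsUnit A.det) (k l : ι) :
    A⁻¹ k l = if k = l then (A k k)⁻¹ else 0 := by
  rw [← hA.diagonal_diag, Matrix.det_diagonal, IsUnit.prod_univ_iff] at hdet
  have hinv : A⁻¹ = Matrix.diagonal fun i => (A i i)⁻¹ := by
    refine Matrix.inv_eq_right_inv ?_
    nth_rw 1 [← hA.diagonal_diag]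
    rw [Matrix.diagonal_mul_diagonal, ← Matrix.diagonal_one]
    exact congrArg _ (funext fun i => mul_inv_cancel₀ (hdet i).ne_zero)
  rw [hinv, Matrix.diagonal_apply]

lemma IsMetricOn.christoffel_eq_zero_of_isDiag (hg : IsMetricOn g U)
    (hdiag : ∀ y ∈ U, (g y).IsDiag) (hx : x ∈ U) {k i j : Fin n} (hki : k ≠ i) (hkj : k ≠ j)
    (hij : i ≠ j) : christoffel g k i j x = 0 := by
  have hpartial (m : Fin n) {i j : Fin n} (hij : i ≠ j) :
      partialDeriv m (fun y => g y i j) x = 0 := by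
    have hzero : (fun y => g y i j) =ᶠ[𝓝 x] fun _ => 0 := by
      filter_upwards [hg.isOpen.mem_nhds hx] with y hy using hdiag y hy hij
    rw [partialDeriv_congr hzero]
    simp [partialDeriv]
  simp [christoffel, inv_apply_of_isDiag (hdiag x hx) (hg.isUnit_det x hx), hpartial _ hij,
    hpartial _ hki.symm, hpartial _ hkj.symm]

lemma curvForm_basisVec_of_nodup
    {Γ : EuclideanSpace ℝ (Fin n) →
      EuclideanSpace ℝ (Fin n) →L[ℝ] EuclideanSpace ℝ (Fin n) →L[ℝ] EuclideanSpace ℝ (Fin n)}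
    (hΓd : DifferentiableAt ℝ Γ x)
    (hΓ : ∀ᶠ y in 𝓝 x, ∀ k i j, k ≠ i → k ≠ j → i ≠ j → Γ y (basisVec i) (basisVec j) k = 0)
    {i j k l : Fin n} (hnodup : [i, j, k, l].Nodup) :
    curvForm Γ x (basisVec i) (basisVec j) (basisVec k) l = 0 := by
  have hfderiv (i : Fin n) {j k l : Fin n} (hlj : l ≠ j) (hlk : l ≠ k) (hjk : j ≠ k) :
      fderiv ℝ Γ x (basisVec i) (basisVec j) (basisVec k) l = 0 := by
    have hd : DifferentiableAt ℝ (fun y => Γ y (basisVec j) (basisVec k)) x := by fun_prop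
    have hproj := (EuclideanSpace.proj (𝕜 := ℝ) l).hasFDerivAt.comp x hd.hasFDerivAt
    have hzero : (EuclideanSpace.proj (𝕜 := ℝ) l) ∘ (fun y => Γ y (basisVec j) (basisVec k))
        =ᶠ[𝓝 x] fun _ => (0 : ℝ) := by
      filter_upwards [hΓ] with y hy using hy l j k hlj hlk hjk
    have h0 := (hasFDerivAt_const (0 : ℝ) x).unique (hproj.congr_of_eventuallyEq hzero.symm)
    rw [← fderiv_bilin_apply hΓd]
    exact (DFunLike.congr_fun h0 (basisVec i)).symm
  have hquad {i j k l : Fin n} (hij : i ≠ j) (hik : i ≠ k) (hil : i ≠ l) (hjk : j ≠ k)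
      (hjl : j ≠ l) (hkl : k ≠ l) : Γ x (basisVec i) (Γ x (basisVec j) (basisVec k)) l = 0 := by
    have hx := hΓ.self_of_nhds
    rw [← sum_smul_basisVec (Γ x (basisVec j) (basisVec k))]
    simp only [map_sum, map_smul, WithLp.ofLp_sum, Finset.sum_apply, WithLp.ofLp_smul,
      Pi.smul_apply, smul_eq_mul]
    refine Finset.sum_eq_zero fun m _ => ?_
    rcases eq_or_ne m j with rfl | hmj
    · rw [hx l i m hil.symm hjl.symm hij, mul_zero]
    rcases eq_or_ne m k with rfl | hmk
    · rw [hx l i m hil.symm hkl.symm hik, mul_zero]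
    rw [hx m j k hmj hmk hjk, zero_mul]
  obtain ⟨⟨hij, hik, hil⟩, ⟨hjk, hjl⟩, hkl⟩ :
      (i ≠ j ∧ i ≠ k ∧ i ≠ l) ∧ (j ≠ k ∧ j ≠ l) ∧ k ≠ l := by simpa using hnodup
  simp [curvForm, hfderiv _ hil.symm hkl.symm hik, hfderiv _ hjl.symm hkl.symm hjk,
    hquad hij.symm hjk hjl hik hil hkl, hquad hij hik hil hjk hjl hkl]

lemma metricForm_basisVec_of_isDiag (hdiag : (g x).IsDiag) (u : EuclideanSpace ℝ (Fin n))
    (l : Fin n) : metricForm g x u (basisVec l) = g x l l * u l := by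
  rw [metricForm_apply, metricInner, Finset.sum_eq_single l]
  · simp [basisVec_apply]
  · intro i _ hil
    simp [basisVec_apply, hdiag hil]
  · simp

lemma IsMetricOn.riemann_basisVec_of_isDiag (hg : IsMetricOn g U)
    (hdiag : ∀ y ∈ U, (g y).IsDiag) (hx : x ∈ U) {i j k l : Fin n}
    (hnodup : [i, j, k, l].Nodup) :
    riemann g x (basisVec i) (basisVec j) (basisVec k) (basisVec l) = 0 := by
  have hΓ : ∀ᶠ y in 𝓝 x, ∀ k i j, k ≠ i → k ≠ j → i ≠ j →
      christoffelForm g y (basisVec i) (basisVec j) k = 0 := by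
    filter_upwards [hg.isOpen.mem_nhds hx] with y hy k i j hki hkj hij
    rw [christoffelForm_basisVec, hg.christoffel_eq_zero_of_isDiag hdiag hy hki hkj hij]
  rw [hg.riemann_eq hx, metricForm_basisVec_of_isDiag (hdiag x hx), curvForm_basisVec_of_nodup
    (hg.differentiableAt_christoffelForm hx) hΓ hnodup, mul_zero]

end Diagonal

end Coordinates

section SelfDual

open Matrix

variable {K : Type*} [Field K]

/-- The Hodge star on skew-symmetric matrices, that is, on bivectors of `K⁴`. -/
def hodgeStar (b : Matrix (Fin 4) (Fin 4) K) : Matrix (Fin 4) (Fin 4) K :=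
  !![0, b 2 3, -b 1 3, b 1 2;
    -b 2 3, 0, b 0 3, -b 0 2;
    b 1 3, -b 0 3, 0, b 0 1;
    -b 1 2, b 0 2, -b 0 1, 0]

/-- The Pfaffian of a skew-symmetric `4 × 4` matrix. -/
def pfaffian (b : Matrix (Fin 4) (Fin 4) K) : K :=
  b 0 1 * b 2 3 - b 0 2 * b 1 3 + b 0 3 * b 1 2

/-- The off-diagonal entries of the first row.  They are coordinates on the skew-symmetric matrices
`b` with `hodgeStar b = p • b`. -/
def firstRow (b : Matrix (Fin 4) (Fin 4) K) : Fin 3 → K :=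
  ![b 0 1, b 0 2, b 0 3]

/-- Coordinates of `b + p • hodgeStar b`, which for `p = 1` and `p = -1` is twice the self-dual and
the anti-self-dual part of the skew-symmetric matrix `b`. -/
def selfDualPart (p : K) (b : Matrix (Fin 4) (Fin 4) K) : Fin 3 → K :=
  firstRow (b + p • hodgeStar b)

/-- The block of the curvature operator `R` on the (anti-)self-dual bivectors of `K⁴`: the
coordinates `selfDualPart p` are taken in both index pairs. -/
def selfDualCurv (p : K) (R : Fin 4 → Fin 4 → Matrix (Fin 4) (Fin 4) K) :
    Matrix (Fin 3) (Fin 3) K :=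
  of fun m n => selfDualPart p (of fun i j => selfDualPart p (R i j) n) m

lemma selfDualPart_eq (p : K) (b : Matrix (Fin 4) (Fin 4) K) :
    selfDualPart p b = ![b 0 1 + p * b 2 3, b 0 2 - p * b 1 3, b 0 3 + p * b 1 2] := by
  simp [selfDualPart, firstRow, hodgeStar, sub_eq_add_neg]

lemma hodgeStar_smul (c : K) (b : Matrix (Fin 4) (Fin 4) K) :
    hodgeStar (c • b) = c • hodgeStar b := by
  simp [hodgeStar]

lemma eq_dotProduct_smul_of_cross_eq_zero {v w : Fin 3 → K} (hv : v ⬝ᵥ v = 1)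
    (h : v ⨯₃ w = 0) : w = (v ⬝ᵥ w) • v := by
  have hcross := cross_cross_eq_smul_sub_smul' v v w
  rw [h, hv, one_smul, map_zero] at hcross
  exact (sub_eq_zero.1 hcross.symm).symm

lemma vecMulVec_eq_smul_of_isSymm {ι : Type*} [Fintype ι] {u v : ι → K} (hv : v ⬝ᵥ v = 1)
    (h : (vecMulVec u v).IsSymm) : vecMulVec u v = (u ⬝ᵥ v) • vecMulVec v v := by
  have hu : u = (u ⬝ᵥ v) • v := by
    calc u = (vecMulVec u v).mulVec v := by simp [vecMulVec_mulVec, hv]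
      _ = (vecMulVec v u).mulVec v := by rw [← h.eq, transpose_vecMulVec]
      _ = (u ⬝ᵥ v) • v := by simp [vecMulVec_mulVec]
  conv_lhs => rw [hu, smul_vecMulVec]

lemma apply_swap_of_skew {ι : Type*} {b : Matrix ι ι K} (hb : bᵀ = -b) (i j : ι) :
    b j i = -b i j :=
  congrFun₂ hb i j

variable [CharZero K] {a b : Matrix (Fin 4) (Fin 4) K} {p : K}

lemma apply_self_of_skew {ι : Type*} {b : Matrix ι ι K} (hb : bᵀ = -b) (i : ι) : b i i = 0 :=
  self_eq_neg.1 (apply_swap_of_skew hb i i)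

lemma hodgeStar_hodgeStar (hb : bᵀ = -b) : hodgeStar (hodgeStar b) = b := by
  have hswap := apply_swap_of_skew hb
  ext i j
  fin_cases i <;> fin_cases j <;>
    simp [hodgeStar, apply_self_of_skew hb, hswap 0 1, hswap 0 2, hswap 0 3, hswap 1 2, hswap 1 3,
      hswap 2 3]

lemma mul_hodgeStar (hb : bᵀ = -b) : b * hodgeStar b = -(pfaffian b • 1) := by
  have hswap := apply_swap_of_skew hb
  ext i j
  fin_cases i <;> fin_cases j <;>
    simp [mul_apply, Fin.sum_univ_four, hodgeStar, pfaffian, apply_self_of_skew hb, hswap 0 1,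
      hswap 0 2, hswap 0 3, hswap 1 2, hswap 1 3, hswap 2 3] <;> ring

lemma hodgeStar_eq_pfaffian_smul (ha : aᵀ = -a) (hsq : a * a = -1) :
    hodgeStar a = pfaffian a • a := by
  have h := congrArg (a * ·) (mul_hodgeStar ha)
  simpa [← mul_assoc, hsq] using h

lemma pfaffian_mul_self (ha : aᵀ = -a) (hsq : a * a = -1) : pfaffian a * pfaffian a = 1 := by
  have hstar := hodgeStar_eq_pfaffian_smul ha hsq
  have ha0 : a ≠ 0 := by
    rintro rfl
    simp at hsq
  have hinv : (pfaffian a * pfaffian a) • a = (1 : K) • a := by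
    rw [one_smul, mul_smul, ← hstar, ← hodgeStar_smul, ← hstar, hodgeStar_hodgeStar ha]
  exact smul_left_injective K ha0 hinv

lemma firstRow_dotProduct_self (ha : aᵀ = -a) (hsq : a * a = -1) :
    firstRow a ⬝ᵥ firstRow a = 1 := by
  have hswap := apply_swap_of_skew ha
  have h : a 0 1 * a 0 1 + a 0 2 * a 0 2 + a 0 3 * a 0 3 = 1 := by
    have h00 := congrFun₂ hsq 0 0
    simp only [mul_apply, Fin.sum_univ_four, apply_self_of_skew ha, hswap 0 1, hswap 0 2,
      hswap 0 3, Matrix.neg_apply, one_apply_eq] at h00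
    linear_combination -h00
  simpa [firstRow, add_assoc] using h

/-- On self-dual parts, the bracket of skew-symmetric matrices is the cross product. -/
lemma firstRow_cross_selfDualPart (ha : aᵀ = -a) (hb : bᵀ = -b) (hstar : hodgeStar a = p • a)
    (hab : Commute a b) : firstRow a ⨯₃ selfDualPart p b = 0 := by
  have h23 : a 2 3 = p * a 0 1 := congrFun₂ hstar 0 1
  have h13 : a 1 3 = -(p * a 0 2) := neg_eq_iff_eq_neg.1 (congrFun₂ hstar 0 2)
  have h12 : a 1 2 = p * a 0 3 := congrFun₂ hstar 0 3
  have hswapa := apply_swap_of_skew ha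
  have hswapb := apply_swap_of_skew hb
  have hbracket (i j : Fin 4) : ∑ k, a i k * b k j = ∑ k, b i k * a k j := congrFun₂ hab.eq i j
  have c12 := hbracket 1 2
  have c13 := hbracket 1 3
  have c23 := hbracket 2 3
  simp only [Fin.sum_univ_four, apply_self_of_skew ha, apply_self_of_skew hb, hswapa 0 1,
    hswapa 0 2, hswapa 1 2, hswapb 0 1, hswapb 0 2, hswapb 1 2, hswapa 2 3, hswapb 2 3, h12, h13,
    h23] at c12 c13 c23
  simp only [cross_apply, firstRow, selfDualPart_eq]
  ext m
  fin_cases m <;> simp only [Fin.zero_eta, Fin.mk_one, Fin.reduceFinMk, cons_val, cons_val_zero,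
    cons_val_one, Pi.zero_apply]
  · linear_combination -c23
  · linear_combination c13
  · linear_combination -c12

end SelfDual

section SelfDualCurv

open Matrix

variable {K : Type*} [Field K] {a : Matrix (Fin 4) (Fin 4) K} {p : K}
  {R : Fin 4 → Fin 4 → Matrix (Fin 4) (Fin 4) K}

lemma selfDualCurv_transpose (p : K) (R : Fin 4 → Fin 4 → Matrix (Fin 4) (Fin 4) K) :
    (selfDualCurv p R)ᵀ = selfDualCurv p fun i j => of fun k l => R k l i j := by
  ext m n
  simp only [transpose_apply, selfDualCurv, of_apply, selfDualPart_eq]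
  fin_cases m <;> fin_cases n <;> simp <;> ring

lemma selfDualCurv_isSymm (hpair : ∀ i j k l, R i j k l = R k l i j) :
    (selfDualCurv p R).IsSymm := by
  have hR : (fun i j => of fun k l => R k l i j) = R := by
    ext i j k l
    exact hpair k l i j
  rw [IsSymm, selfDualCurv_transpose, hR]

lemma selfDualCurv_apply_self (hp : p * p = 1)
    (hdist : ∀ i j k l, [i, j, k, l].Nodup → R i j k l = 0) :
    selfDualCurv p R 0 0 = R 0 1 0 1 + R 2 3 2 3 ∧
      selfDualCurv p R 1 1 = R 0 2 0 2 + R 1 3 1 3 ∧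
      selfDualCurv p R 2 2 = R 0 3 0 3 + R 1 2 1 2 := by
  have h1 := hdist 0 1 2 3 (by decide)
  have h2 := hdist 2 3 0 1 (by decide)
  have h3 := hdist 0 2 1 3 (by decide)
  have h4 := hdist 1 3 0 2 (by decide)
  have h5 := hdist 0 3 1 2 (by decide)
  have h6 := hdist 1 2 0 3 (by decide)
  simp [selfDualCurv, selfDualPart_eq, h1, h2, h3, h4, h5, h6, ← mul_assoc, hp]

variable [CharZero K]

lemma two_mul_trace_selfDualCurv (hp : p * p = 1) (hskew : ∀ i j, (R i j)ᵀ = -R i j)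
    (hpair : ∀ i j k l, R i j k l = R k l i j)
    (hdist : ∀ i j k l, [i, j, k, l].Nodup → R i j k l = 0) :
    2 * (selfDualCurv p R).trace = ∑ i, ∑ j, R i j i j := by
  have hright (i j k l : Fin 4) : R i j l k = -R i j k l := apply_swap_of_skew (hskew i j) k l
  have hself (i j : Fin 4) : R i i i j = 0 := by
    rw [hpair, apply_self_of_skew (hskew i j)]
  have hswap (i j : Fin 4) : R j i j i = R i j i j := by
    rw [hright, hpair, hright, neg_neg]
  obtain ⟨h0, h1, h2⟩ := selfDualCurv_apply_self hp hdist
  simp only [trace_fin_three, h0, h1, h2, Fin.sum_univ_four, hself, hswap 0 1, hswap 0 2,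
    hswap 0 3, hswap 1 2, hswap 1 3, hswap 2 3]
  ring

lemma selfDualCurv_eq_smul (ha : aᵀ = -a) (hsq : a * a = -1) (hstar : hodgeStar a = p • a)
    (hskew : ∀ i j, (R i j)ᵀ = -R i j) (hpair : ∀ i j k l, R i j k l = R k l i j)
    (hcomm : ∀ i j, Commute a (R i j)) :
    selfDualCurv p R = (selfDualCurv p R).trace • vecMulVec (firstRow a) (firstRow a) := by
  have hv := firstRow_dotProduct_self ha hsq
  set f : Matrix (Fin 4) (Fin 4) K := of fun i j => firstRow a ⬝ᵥ selfDualPart p (R i j)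
  have hparallel (i j : Fin 4) : selfDualPart p (R i j) = f i j • firstRow a :=
    eq_dotProduct_smul_of_cross_eq_zero hv
      (firstRow_cross_selfDualPart ha (hskew i j) hstar (hcomm i j))
  have hrank : selfDualCurv p R = vecMulVec (selfDualPart p f) (firstRow a) := by
    ext m n
    simp only [selfDualCurv, hparallel, vecMulVec_apply, of_apply, selfDualPart_eq]
    fin_cases m <;> simp <;> ring
  have hsymm := selfDualCurv_isSymm (p := p) hpair
  rw [hrank] at hsymm ⊢
  rw [trace_vecMulVec, ← vecMulVec_eq_smul_of_isSymm hv hsymm]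

lemma two_mul_curvature_sum_eq (ha : aᵀ = -a) (hsq : a * a = -1)
    (hskew : ∀ i j, (R i j)ᵀ = -R i j) (hpair : ∀ i j k l, R i j k l = R k l i j)
    (hcomm : ∀ i j, Commute a (R i j)) (hdist : ∀ i j k l, [i, j, k, l].Nodup → R i j k l = 0) :
    2 * (R 0 1 0 1 + R 2 3 2 3) = a 0 1 ^ 2 * ∑ i, ∑ j, R i j i j ∧
      2 * (R 0 2 0 2 + R 1 3 1 3) = a 0 2 ^ 2 * ∑ i, ∑ j, R i j i j ∧
      2 * (R 0 3 0 3 + R 1 2 1 2) = a 0 3 ^ 2 * ∑ i, ∑ j, R i j i j := by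
  have hp := pfaffian_mul_self ha hsq
  have hrank := selfDualCurv_eq_smul ha hsq (hodgeStar_eq_pfaffian_smul ha hsq) hskew hpair hcomm
  have hentry (m : Fin 3) : 2 * selfDualCurv (pfaffian a) R m m =
      firstRow a m ^ 2 * ∑ i, ∑ j, R i j i j := by
    rw [← two_mul_trace_selfDualCurv hp hskew hpair hdist]
    conv_lhs => rw [hrank]
    rw [Matrix.smul_apply, vecMulVec_apply, smul_eq_mul]
    ring
  obtain ⟨h0, h1, h2⟩ := selfDualCurv_apply_self hp hdist
  exact ⟨h0 ▸ hentry 0, h1 ▸ hentry 1, h2 ▸ hentry 2⟩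

end SelfDualCurv

section Charts

open Topology

variable {n : ℕ} {M : Type*} [TopologicalSpace M] [ChartedSpace (EuclideanSpace ℝ (Fin n)) M]
  {φ : OpenPartialHomeomorph M (EuclideanSpace ℝ (Fin n))}
  {J : ∀ p : M, TangentSpace (𝓡 n) p →L[ℝ] TangentSpace (𝓡 n) p}
  {x : EuclideanSpace ℝ (Fin n)}

/-- The tangent vector `∑ vᵢ ∂/∂xᵢ` at `φ⁻¹(x)` with components `v` in the chart `φ`. -/
def chartVec (φ : OpenPartialHomeomorph M (EuclideanSpace ℝ (Fin n)))
    (x : EuclideanSpace ℝ (Fin n)) :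
    EuclideanSpace ℝ (Fin n) →L[ℝ] TangentSpace (𝓡 n) (φ.symm x) :=
  mfderiv (𝓡 n) (𝓡 n) φ.symm x

/-- The components in the chart `φ` of a tangent vector at `φ⁻¹(x)`. -/
def chartComponents (φ : OpenPartialHomeomorph M (EuclideanSpace ℝ (Fin n)))
    (x : EuclideanSpace ℝ (Fin n)) :
    TangentSpace (𝓡 n) (φ.symm x) →L[ℝ] EuclideanSpace ℝ (Fin n) :=
  mfderiv (𝓡 n) (𝓡 n) φ (φ.symm x)

/-- `chartEndo J φ x` as a continuous linear map. -/
def chartEndoCLM (J : ∀ p : M, TangentSpace (𝓡 n) p →L[ℝ] TangentSpace (𝓡 n) p)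
    (φ : OpenPartialHomeomorph M (EuclideanSpace ℝ (Fin n))) (x : EuclideanSpace ℝ (Fin n)) :
    EuclideanSpace ℝ (Fin n) →L[ℝ] EuclideanSpace ℝ (Fin n) :=
  chartComponents φ x ∘L J (φ.symm x) ∘L chartVec φ x

lemma mdifferentiable_of_mem_maximalAtlas
    (hφ : φ ∈ IsManifold.maximalAtlas (𝓡 n) ∞ M) : φ.MDifferentiable (𝓡 n) (𝓡 n) :=
  ⟨(contMDiffOn_of_mem_maximalAtlas hφ).mdifferentiableOn (by simp),
    (contMDiffOn_symm_of_mem_maximalAtlas hφ).mdifferentiableOn (by simp)⟩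

lemma chartComponents_chartVec (hφ : φ ∈ IsManifold.maximalAtlas (𝓡 n) ∞ M) (hx : x ∈ φ.target)
    (v : EuclideanSpace ℝ (Fin n)) : chartComponents φ x (chartVec φ x v) = v :=
  DFunLike.congr_fun ((mdifferentiable_of_mem_maximalAtlas hφ).comp_symm_deriv hx) v

lemma chartVec_chartComponents (hφ : φ ∈ IsManifold.maximalAtlas (𝓡 n) ∞ M) (hx : x ∈ φ.target)
    (v : TangentSpace (𝓡 n) (φ.symm x)) : chartVec φ x (chartComponents φ x v) = v := by
  have h := (mdifferentiable_of_mem_maximalAtlas hφ).symm_comp_deriv (φ.map_target hx)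
  rw [φ.right_inv hx] at h
  exact DFunLike.congr_fun h v

lemma chartVec_chartEndoCLM (hφ : φ ∈ IsManifold.maximalAtlas (𝓡 n) ∞ M) (hx : x ∈ φ.target)
    (v : EuclideanSpace ℝ (Fin n)) :
    chartVec φ x (chartEndoCLM J φ x v) = J (φ.symm x) (chartVec φ x v) :=
  chartVec_chartComponents hφ hx _

lemma chartVec_eq_sum (v : EuclideanSpace ℝ (Fin n)) :
    chartVec φ x v = ∑ i, v i • coordVec φ i x := by
  conv_lhs => rw [← sum_smul_basisVec v, map_sum]
  exact Finset.sum_congr rfl fun i _ => map_smul _ _ _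

lemma linearIndependent_coordVec (hφ : φ ∈ IsManifold.maximalAtlas (𝓡 n) ∞ M)
    (hx : x ∈ φ.target) : LinearIndependent ℝ fun i => coordVec φ i x := by
  have hbasis : LinearIndependent ℝ (basisVec : Fin n → EuclideanSpace ℝ (Fin n)) := by
    have hfun : ⇑(EuclideanSpace.basisFun (Fin n) ℝ) = basisVec :=
      funext fun i => EuclideanSpace.basisFun_apply (Fin n) ℝ i
    exact hfun ▸ (EuclideanSpace.basisFun (Fin n) ℝ).orthonormal.linearIndependent
  exact hbasis.map' (chartVec φ x).toLinearMap
    (LinearMap.ker_eq_bot.2 (Function.LeftInverse.injective (chartComponents_chartVec hφ hx)))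

section Smoothness

variable [IsManifold (𝓡 n) ∞ M]

lemma contMDiffOn_chartVec (hφ : φ ∈ IsManifold.maximalAtlas (𝓡 n) ∞ M)
    (v : EuclideanSpace ℝ (Fin n)) :
    ContMDiffOn (𝓡 n) ((𝓡 n).prod (𝓡 n)) ∞
      (fun y => Bundle.TotalSpace.mk' (EuclideanSpace ℝ (Fin n))
        (E := fun p : M => TangentSpace (𝓡 n) p) (φ.symm y) (chartVec φ y v)) φ.target := by
  have htangent := (contMDiffOn_symm_of_mem_maximalAtlas hφ).contMDiffOn_tangentMapWithin
    (m := ∞) (by simp) φ.open_target.uniqueMDiffOn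
  have hconst : ContMDiffOn (𝓡 n) (𝓡 n).tangent ∞
      (fun y => (⟨y, v⟩ : TangentBundle (𝓡 n) (EuclideanSpace ℝ (Fin n)))) φ.target :=
    contMDiffOn_vectorSpace_iff_contDiffOn.2 contDiffOn_const
  refine (htangent.comp hconst fun y hy => hy).congr fun y hy => ?_
  simp only [Function.comp, tangentMapWithin, mfderivWithin_of_isOpen φ.open_target hy]
  rfl

lemma IsKahler.contDiffOn_chartEndo [Bundle.RiemannianBundle (fun p : M => TangentSpace (𝓡 n) p)]
    (hJ : IsKahler J) (hφ : φ ∈ IsManifold.maximalAtlas (𝓡 n) ∞ M)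
    (v : EuclideanSpace ℝ (Fin n)) : ContDiffOn ℝ ∞ (fun y => chartEndo J φ y v) φ.target := by
  have htangent := (contMDiffOn_of_mem_maximalAtlas hφ).contMDiffOn_tangentMapWithin
    (m := ∞) (by simp) φ.open_source.uniqueMDiffOn
  have hJv := ContMDiffOn.clm_bundle_apply (b := φ.symm) (ϕ := fun y => J (φ.symm y))
    (hJ.smooth.comp_contMDiffOn (contMDiffOn_symm_of_mem_maximalAtlas hφ))
    (contMDiffOn_chartVec hφ v)
  have hcomp := (contMDiff_snd_tangentBundle_modelSpace (EuclideanSpace ℝ (Fin n))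
    (𝓡 n)).comp_contMDiffOn (htangent.comp hJv fun y hy => φ.map_target hy)
  refine hcomp.contDiffOn.congr fun y hy => ?_
  simp only [Function.comp, tangentMapWithin,
    mfderivWithin_of_isOpen φ.open_source (φ.map_target hy)]
  rfl

end Smoothness

variable [Bundle.RiemannianBundle (fun p : M => TangentSpace (𝓡 n) p)]

lemma metricForm_chartMetric (x u v : EuclideanSpace ℝ (Fin n)) :
    metricForm (chartMetric φ) x u v = inner ℝ (chartVec φ x u) (chartVec φ x v) := by
  simp only [metricForm_apply, metricInner, chartVec_eq_sum, sum_inner, inner_sum,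
    real_inner_smul_left, real_inner_smul_right, chartMetric, Matrix.of_apply]
  rw [Finset.sum_comm]
  exact Finset.sum_congr rfl fun i _ => Finset.sum_congr rfl fun j _ => by ring

lemma contDiffOn_chartMetric [IsManifold (𝓡 n) ∞ M]
    [IsContMDiffRiemannianBundle (𝓡 n) ∞ (EuclideanSpace ℝ (Fin n))
      (fun p : M => TangentSpace (𝓡 n) p)]
    (hφ : φ ∈ IsManifold.maximalAtlas (𝓡 n) ∞ M) (i j : Fin n) :
    ContDiffOn ℝ ∞ (fun y => chartMetric φ y i j) φ.target := by
  have hinner := ContMDiffOn.inner_bundle (contMDiffOn_chartVec hφ (basisVec i))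
    (contMDiffOn_chartVec hφ (basisVec j))
  exact hinner.contDiffOn

lemma isMetricOn_chartMetric [IsManifold (𝓡 n) ∞ M]
    [IsContMDiffRiemannianBundle (𝓡 n) ∞ (EuclideanSpace ℝ (Fin n))
      (fun p : M => TangentSpace (𝓡 n) p)]
    (hφ : φ ∈ IsManifold.maximalAtlas (𝓡 n) ∞ M) : IsMetricOn (chartMetric φ) φ.target where
  isOpen := φ.open_target
  contDiffOn := contDiffOn_chartMetric hφ
  isSymm y _ := Matrix.IsSymm.ext fun i j => real_inner_comm (coordVec φ i y) (coordVec φ j y)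
  isUnit_det y hy := by
    have hgram : (Matrix.gram ℝ fun i => coordVec φ i y).PosDef :=
      Matrix.posDef_gram_of_linearIndependent (linearIndependent_coordVec hφ hy)
    exact hgram.det_pos.ne'.isUnit

namespace IsKahler

variable [IsManifold (𝓡 n) ∞ M]

lemma chartEndoCLM_comp_self (hJ : IsKahler J) (hφ : φ ∈ IsManifold.maximalAtlas (𝓡 n) ∞ M)
    (hx : x ∈ φ.target) :
    chartEndoCLM J φ x ∘L chartEndoCLM J φ x = -ContinuousLinearMap.id ℝ _ := by
  ext1 v
  refine (Function.LeftInverse.injective (chartComponents_chartVec hφ hx)) ?_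
  simp [chartVec_chartEndoCLM hφ hx, hJ.sq_eq_neg]

lemma metricForm_chartEndoCLM (hJ : IsKahler J) (hφ : φ ∈ IsManifold.maximalAtlas (𝓡 n) ∞ M)
    (hx : x ∈ φ.target) (u v : EuclideanSpace ℝ (Fin n)) :
    metricForm (chartMetric φ) x (chartEndoCLM J φ x u) v =
      -metricForm (chartMetric φ) x u (chartEndoCLM J φ x v) := by
  rw [metricForm_chartMetric, metricForm_chartMetric, chartVec_chartEndoCLM hφ hx,
    chartVec_chartEndoCLM hφ hx, ← hJ.isometry _ (chartVec φ x u), hJ.sq_eq_neg, inner_neg_right,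
    neg_neg]

/-- Both second covariant derivatives in the curvature commute with `J`, as `J` is parallel. -/
lemma curvForm_comp_chartEndoCLM
    [IsContMDiffRiemannianBundle (𝓡 n) ∞ (EuclideanSpace ℝ (Fin n))
      (fun p : M => TangentSpace (𝓡 n) p)]
    (hJ : IsKahler J) (hφ : φ ∈ IsManifold.maximalAtlas (𝓡 n) ∞ M) (hx : x ∈ φ.target)
    (u v : EuclideanSpace ℝ (Fin n)) :
    curvForm (christoffelForm (chartMetric φ)) x u v ∘L chartEndoCLM J φ x =
      chartEndoCLM J φ x ∘L curvForm (christoffelForm (chartMetric φ)) x u v := by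
  ext1 w
  have hg := isMetricOn_chartMetric hφ
  have hΓ := hg.differentiableAt_christoffelForm hx
  have hJw : ContDiffAt ℝ 2 (fun y => chartEndoCLM J φ y w) x :=
    ((hJ.contDiffOn_chartEndo hφ w).contDiffAt (hg.isOpen.mem_nhds hx)).of_le ENat.LEInfty.out
  have hcov (u : EuclideanSpace ℝ (Fin n)) :
      ContDiffOn ℝ ∞ (covDeriv (chartMetric φ) (fun _ => u) fun _ => w) φ.target := by
    simpa [funext (covDeriv_eq _ _), covDerivConst] using
      (hg.contDiffOn_christoffelForm.clm_apply contDiffOn_const).clm_apply contDiffOn_const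
  have hsecond (u v : EuclideanSpace ℝ (Fin n)) :
      covDeriv (chartMetric φ) (fun _ => u)
        (covDeriv (chartMetric φ) (fun _ => v) fun y => chartEndoCLM J φ y w) x =
      chartEndoCLM J φ x (covDeriv (chartMetric φ) (fun _ => u)
        (covDeriv (chartMetric φ) (fun _ => v) fun _ => w) x) := by
    refine Eq.trans (covDeriv_congr ?_) (hJ.parallel φ hφ _ _ contDiffOn_const (hcov v) x hx)
    filter_upwards [hg.isOpen.mem_nhds hx] with y hy
    exact hJ.parallel φ hφ _ _ contDiffOn_const contDiffOn_const y hy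
  have hbracket : covDeriv (chartMetric φ) (VectorField.lieBracket ℝ (fun _ => u) fun _ => v)
      (fun y => chartEndoCLM J φ y w) x = chartEndoCLM J φ x (covDeriv (chartMetric φ)
        (VectorField.lieBracket ℝ (fun _ => u) fun _ => v) (fun _ => w) x) := by
    simp [covDeriv_eq, covDerivConst, VectorField.lieBracket]
  calc curvForm (christoffelForm (chartMetric φ)) x u v (chartEndoCLM J φ x w)
      = curvOp (chartMetric φ) (fun _ => u) (fun _ => v) (fun y => chartEndoCLM J φ y w) x :=
        (curvOp_const hΓ hJw u v).symm
    _ = chartEndoCLM J φ x (curvOp (chartMetric φ) (fun _ => u) (fun _ => v) (fun _ => w) x) := by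
        rw [curvOp, curvOp, hbracket, hsecond, hsecond, map_add, map_sub]
    _ = chartEndoCLM J φ x (curvForm (christoffelForm (chartMetric φ)) x u v w) := by
        rw [curvOp_const hΓ contDiffAt_const]

end IsKahler

end Charts

section Frame

open scoped Matrix

variable {n : ℕ} {M : Type*} [TopologicalSpace M] [ChartedSpace (EuclideanSpace ℝ (Fin n)) M]
  [Bundle.RiemannianBundle (fun p : M => TangentSpace (𝓡 n) p)]
  {φ : OpenPartialHomeomorph M (EuclideanSpace ℝ (Fin n))}
  {J : ∀ p : M, TangentSpace (𝓡 n) p →L[ℝ] TangentSpace (𝓡 n) p}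
  {x : EuclideanSpace ℝ (Fin n)}

/-- The matrix `(⟨L eᵢ, eⱼ⟩)ᵢⱼ` of `L` in the frame associated to `φ`; its rows, not its columns,
are the images of the frame vectors, as in `frameComplex`. -/
def frameMatrix (φ : OpenPartialHomeomorph M (EuclideanSpace ℝ (Fin n)))
    (x : EuclideanSpace ℝ (Fin n))
    (L : EuclideanSpace ℝ (Fin n) →L[ℝ] EuclideanSpace ℝ (Fin n)) : Matrix (Fin n) (Fin n) ℝ :=
  Matrix.of fun i j => metricForm (chartMetric φ) x (L (frameCoord φ i x)) (frameCoord φ j x)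

lemma frameMatrix_neg (L : EuclideanSpace ℝ (Fin n) →L[ℝ] EuclideanSpace ℝ (Fin n)) :
    frameMatrix φ x (-L) = -frameMatrix φ x L := by
  ext i j
  simp [frameMatrix]

lemma scaleFactor_mul_self (i : Fin n) :
    scaleFactor φ i x * scaleFactor φ i x = chartMetric φ x i i :=
  Real.mul_self_sqrt real_inner_self_nonneg

lemma scaleFactor_ne_zero (hφ : φ ∈ IsManifold.maximalAtlas (𝓡 n) ∞ M) (hx : x ∈ φ.target)
    (i : Fin n) : scaleFactor φ i x ≠ 0 :=
  Real.sqrt_ne_zero'.2 (real_inner_self_pos.2 ((linearIndependent_coordVec hφ hx).ne_zero i))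

lemma frameVec_eq_chartVec (i : Fin n) : frameVec φ i x = chartVec φ x (frameCoord φ i x) :=
  (map_smul (chartVec φ x) _ _).symm

lemma frameComplex_eq_frameMatrix (hφ : φ ∈ IsManifold.maximalAtlas (𝓡 n) ∞ M)
    (hx : x ∈ φ.target) :
    Matrix.of (frameComplex J φ x) = frameMatrix φ x (chartEndoCLM J φ x) := by
  ext i j
  rw [frameMatrix, Matrix.of_apply, Matrix.of_apply, metricForm_chartMetric,
    chartVec_chartEndoCLM hφ hx, frameComplex, frameVec_eq_chartVec, frameVec_eq_chartVec]

namespace IsOrthogonalChart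

lemma isDiag_chartMetric (hφ : IsOrthogonalChart φ) (hx : x ∈ φ.target) :
    (chartMetric φ x).IsDiag :=
  fun i j hij => hφ.orthogonal x hx i j hij

lemma metricForm_frameCoord (hφ : IsOrthogonalChart φ) (hx : x ∈ φ.target)
    (v : EuclideanSpace ℝ (Fin n)) (i : Fin n) :
    metricForm (chartMetric φ) x v (frameCoord φ i x) = scaleFactor φ i x * v i := by
  rw [frameCoord, map_smul, metricForm_basisVec_of_isDiag (hφ.isDiag_chartMetric hx),
    ← scaleFactor_mul_self, smul_eq_mul, mul_assoc,
    inv_mul_cancel_left₀ (scaleFactor_ne_zero hφ.smooth hx i)]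

lemma sum_metricForm_smul_frameCoord (hφ : IsOrthogonalChart φ) (hx : x ∈ φ.target)
    (v : EuclideanSpace ℝ (Fin n)) :
    ∑ i, metricForm (chartMetric φ) x v (frameCoord φ i x) • frameCoord φ i x = v := by
  conv_rhs => rw [← sum_smul_basisVec v]
  refine Finset.sum_congr rfl fun i _ => ?_
  rw [hφ.metricForm_frameCoord hx, frameCoord, smul_smul, mul_comm,
    inv_mul_cancel_left₀ (scaleFactor_ne_zero hφ.smooth hx i)]

lemma frameMatrix_id (hφ : IsOrthogonalChart φ) (hx : x ∈ φ.target) :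
    frameMatrix φ x (ContinuousLinearMap.id ℝ _) = 1 := by
  ext i j
  have hj := scaleFactor_ne_zero hφ.smooth hx j
  rw [frameMatrix, Matrix.of_apply, ContinuousLinearMap.id_apply, hφ.metricForm_frameCoord hx,
    frameCoord]
  rcases eq_or_ne j i with rfl | hij
  · simp [basisVec_apply, hj]
  · simp [basisVec_apply, hij, hij.symm]

lemma frameMatrix_mul (hφ : IsOrthogonalChart φ) (hx : x ∈ φ.target)
    (A B : EuclideanSpace ℝ (Fin n) →L[ℝ] EuclideanSpace ℝ (Fin n)) :
    frameMatrix φ x A * frameMatrix φ x B = frameMatrix φ x (B ∘L A) := by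
  ext i j
  simp only [Matrix.mul_apply, frameMatrix, Matrix.of_apply, ContinuousLinearMap.comp_apply]
  conv_rhs => rw [← hφ.sum_metricForm_smul_frameCoord hx (A (frameCoord φ i x))]
  simp only [map_sum, map_smul, sum_apply, smul_apply, smul_eq_mul]

lemma frameMatrix_transpose_of_skew (hφ : IsOrthogonalChart φ) (hx : x ∈ φ.target)
    {L : EuclideanSpace ℝ (Fin n) →L[ℝ] EuclideanSpace ℝ (Fin n)}
    (hL : ∀ u v, metricForm (chartMetric φ) x (L u) v = -metricForm (chartMetric φ) x u (L v)) :
    (frameMatrix φ x L)ᵀ = -frameMatrix φ x L := by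
  ext i j
  simp only [Matrix.transpose_apply, Matrix.neg_apply, frameMatrix, Matrix.of_apply]
  rw [hL, metricForm_symm (hφ.isDiag_chartMetric hx).isSymm]

variable [IsManifold (𝓡 n) ∞ M]
  [IsContMDiffRiemannianBundle (𝓡 n) ∞ (EuclideanSpace ℝ (Fin n))
    (fun p : M => TangentSpace (𝓡 n) p)]

lemma frameCurv_eq_frameMatrix (hφ : IsOrthogonalChart φ) (hx : x ∈ φ.target) (i j : Fin n) :
    Matrix.of (frameCurv φ x i j) = frameMatrix φ x
      (curvForm (christoffelForm (chartMetric φ)) x (frameCoord φ i x) (frameCoord φ j x)) := by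
  ext k l
  exact (isMetricOn_chartMetric hφ.smooth).riemann_eq hx _ _ _ _

lemma frameCurv_eq_zero_of_nodup (hφ : IsOrthogonalChart φ) (hx : x ∈ φ.target)
    {i j k l : Fin n} (hnodup : [i, j, k, l].Nodup) : frameCurv φ x i j k l = 0 := by
  have hg := isMetricOn_chartMetric hφ.smooth
  simp only [frameCurv, frameCoord]
  rw [hg.riemann_smul hx, hg.riemann_basisVec_of_isDiag (fun y hy => hφ.isDiag_chartMetric hy)
    hx hnodup, mul_zero]

lemma scalarCurv_eq_sum_frameCurv (hφ : IsOrthogonalChart φ) (hx : x ∈ φ.target) :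
    scalarCurv (chartMetric φ) x = ∑ i, ∑ j, frameCurv φ x i j i j := by
  have hg := isMetricOn_chartMetric hφ.smooth
  refine Finset.sum_congr rfl fun i _ => Finset.sum_congr rfl fun j _ => ?_
  simp only [inv_apply_of_isDiag (hφ.isDiag_chartMetric hx) (hg.isUnit_det x hx), ite_mul,
    mul_ite, zero_mul, mul_zero, Finset.sum_ite_eq, Finset.mem_univ, if_true]
  simp only [frameCurv, frameCoord]
  rw [hg.riemann_smul hx, ← scaleFactor_mul_self, ← scaleFactor_mul_self, mul_inv, mul_inv]
  ring

end IsOrthogonalChart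

end Frame

section Kahler

variable {M : Type*} [TopologicalSpace M] [ChartedSpace (EuclideanSpace ℝ (Fin 4)) M]
  [IsManifold (𝓡 4) ∞ M] [Bundle.RiemannianBundle (fun p : M => TangentSpace (𝓡 4) p)]
  [IsContMDiffRiemannianBundle (𝓡 4) ∞ (EuclideanSpace ℝ (Fin 4))
    (fun p : M => TangentSpace (𝓡 4) p)]
  {φ : OpenPartialHomeomorph M (EuclideanSpace ℝ (Fin 4))}
  {J : ∀ p : M, TangentSpace (𝓡 4) p →L[ℝ] TangentSpace (𝓡 4) p}
  {x : EuclideanSpace ℝ (Fin 4)}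

lemma IsKahler.two_mul_frameCurv_sum_eq (hJ : IsKahler J) (hφ : IsOrthogonalChart φ)
    (hx : x ∈ φ.target) :
    2 * (frameCurv φ x 0 1 0 1 + frameCurv φ x 2 3 2 3) =
        frameComplex J φ x 0 1 ^ 2 * scalarCurv (chartMetric φ) x ∧
      2 * (frameCurv φ x 0 2 0 2 + frameCurv φ x 1 3 1 3) =
        frameComplex J φ x 0 2 ^ 2 * scalarCurv (chartMetric φ) x ∧
      2 * (frameCurv φ x 0 3 0 3 + frameCurv φ x 1 2 1 2) =
        frameComplex J φ x 0 3 ^ 2 * scalarCurv (chartMetric φ) x := by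
  have hg := isMetricOn_chartMetric hφ.smooth
  have hJx := frameComplex_eq_frameMatrix (J := J) hφ.smooth hx
  have hRx := hφ.frameCurv_eq_frameMatrix hx
  rw [hφ.scalarCurv_eq_sum_frameCurv hx]
  refine two_mul_curvature_sum_eq (a := Matrix.of (frameComplex J φ x))
    (R := fun i j => Matrix.of (frameCurv φ x i j)) ?_ ?_ (fun i j => ?_)
    (fun i j k l => hg.riemann_pair_symm hx _ _ _ _) (fun i j => ?_)
    (fun i j k l hnodup => hφ.frameCurv_eq_zero_of_nodup hx hnodup)
  · rw [hJx, hφ.frameMatrix_transpose_of_skew hx (hJ.metricForm_chartEndoCLM hφ.smooth hx)]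
  · rw [hJx, hφ.frameMatrix_mul hx, hJ.chartEndoCLM_comp_self hφ.smooth hx, frameMatrix_neg,
      hφ.frameMatrix_id hx]
  · rw [hRx, hφ.frameMatrix_transpose_of_skew hx (hg.curvForm_skew hx _ _)]
  · rw [hJx, hRx, Commute, SemiconjBy, hφ.frameMatrix_mul hx, hφ.frameMatrix_mul hx,
      hJ.curvForm_comp_chartEndoCLM hφ.smooth hx]

end Kahler

section Sign

variable {K : Type*} [Field K] {r s b : K}

lemma eq_two_div_sq_mul (h : 2 * s = b ^ 2 * r) (hb : b ≠ 0) : r = 2 / b ^ 2 * s := by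
  rw [div_mul_eq_mul_div, h, mul_div_cancel_left₀ _ (pow_ne_zero 2 hb)]

lemma eq_zero_of_two_mul_eq_sq_mul [CharZero K] (h : 2 * s = b ^ 2 * r) (hb : b = 0) : s = 0 := by
  simpa [hb] using h

variable [LinearOrder K] [IsStrictOrderedRing K]

lemma sign_eq_of_two_mul_eq_sq_mul (h : 2 * s = b ^ 2 * r) (hb : b ≠ 0) :
    SignType.sign s = SignType.sign r := by
  have hsign := congrArg SignType.sign h
  rwa [sign_mul, sign_mul, sign_pos zero_lt_two, sign_pos (sq_pos_of_ne_zero hb), one_mul, one_mul]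
    at hsign

lemma nonneg_of_two_mul_eq_sq_mul (h : 2 * s = b ^ 2 * r) (hr : 0 ≤ r) : 0 ≤ s :=
  nonneg_of_mul_nonneg_right (h ▸ mul_nonneg (sq_nonneg b) hr) zero_lt_two

lemma nonpos_of_two_mul_eq_sq_mul (h : 2 * s = b ^ 2 * r) (hr : r ≤ 0) : s ≤ 0 :=
  nonpos_of_mul_nonpos_right (h ▸ mul_nonpos_of_nonneg_of_nonpos (sq_nonneg b) hr) zero_lt_two

end Sign

end OrthCoord

end

theorem mainTheorem5 {M : Type*} [TopologicalSpace M]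
    [ChartedSpace (EuclideanSpace ℝ (Fin 4)) M] [IsManifold (𝓡 4) ∞ M]
    [Bundle.RiemannianBundle (fun p : M => TangentSpace (𝓡 4) p)]
    [IsContMDiffRiemannianBundle (𝓡 4) ∞ (EuclideanSpace ℝ (Fin 4))
      (fun p : M => TangentSpace (𝓡 4) p)]
    (J : ∀ p : M, TangentSpace (𝓡 4) p →L[ℝ] TangentSpace (𝓡 4) p)
    (hJ : OrthCoord.IsKahler J)
    (φ : OpenPartialHomeomorph M (EuclideanSpace ℝ (Fin 4)))
    (hφ : OrthCoord.IsOrthogonalChart φ)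
    (x : EuclideanSpace ℝ (Fin 4)) (hx : x ∈ φ.target) :
    let R := OrthCoord.frameCurv φ x
    let a := OrthCoord.frameComplex J φ x
    let r := OrthCoord.scalarCurv (OrthCoord.chartMetric φ) x
    -- the formula for the scalar curvature
    ((a 0 1 ≠ 0 → r = 2 / (a 0 1) ^ 2 * (R 0 1 0 1 + R 2 3 2 3)) ∧
      (a 0 2 ≠ 0 → r = 2 / (a 0 2) ^ 2 * (R 0 2 0 2 + R 1 3 1 3)) ∧
      (a 0 3 ≠ 0 → r = 2 / (a 0 3) ^ 2 * (R 0 3 0 3 + R 1 2 1 2))) ∧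
    -- its form when a component of the complex structure vanishes
    ((a 0 1 = 0 → R 0 1 0 1 + R 2 3 2 3 = 0) ∧
      (a 0 2 = 0 → R 0 2 0 2 + R 1 3 1 3 = 0) ∧
      (a 0 3 = 0 → R 0 3 0 3 + R 1 2 1 2 = 0)) ∧
    -- the three sums have the same sign
    ((a 0 1 ≠ 0 → SignType.sign (R 0 1 0 1 + R 2 3 2 3) = SignType.sign r) ∧
      (a 0 2 ≠ 0 → SignType.sign (R 0 2 0 2 + R 1 3 1 3) = SignType.sign r) ∧
      (a 0 3 ≠ 0 → SignType.sign (R 0 3 0 3 + R 1 2 1 2) = SignType.sign r)) ∧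
    ((0 ≤ R 0 1 0 1 + R 2 3 2 3 ∧ 0 ≤ R 0 2 0 2 + R 1 3 1 3 ∧ 0 ≤ R 0 3 0 3 + R 1 2 1 2) ∨
      (R 0 1 0 1 + R 2 3 2 3 ≤ 0 ∧ R 0 2 0 2 + R 1 3 1 3 ≤ 0 ∧ R 0 3 0 3 + R 1 2 1 2 ≤ 0)) := by
  intro R a r
  obtain ⟨h₁, h₂, h₃⟩ := hJ.two_mul_frameCurv_sum_eq hφ hx
  refine ⟨⟨OrthCoord.eq_two_div_sq_mul h₁, OrthCoord.eq_two_div_sq_mul h₂,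
      OrthCoord.eq_two_div_sq_mul h₃⟩,
    ⟨OrthCoord.eq_zero_of_two_mul_eq_sq_mul h₁, OrthCoord.eq_zero_of_two_mul_eq_sq_mul h₂,
      OrthCoord.eq_zero_of_two_mul_eq_sq_mul h₃⟩,
    ⟨OrthCoord.sign_eq_of_two_mul_eq_sq_mul h₁, OrthCoord.sign_eq_of_two_mul_eq_sq_mul h₂,
      OrthCoord.sign_eq_of_two_mul_eq_sq_mul h₃⟩, ?_⟩
  rcases le_total 0 r with hr | hr
  · exact Or.inl ⟨OrthCoord.nonneg_of_two_mul_eq_sq_mul h₁ hr,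
      OrthCoord.nonneg_of_two_mul_eq_sq_mul h₂ hr, OrthCoord.nonneg_of_two_mul_eq_sq_mul h₃ hr⟩
  · exact Or.inr ⟨OrthCoord.nonpos_of_two_mul_eq_sq_mul h₁ hr,
      OrthCoord.nonpos_of_two_mul_eq_sq_mul h₂ hr, OrthCoord.nonpos_of_two_mul_eq_sq_mul h₃ hr⟩
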